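/- **Proposition 5.1.** Let $W=(W_{x,s})_{x\ge 0,\,s\ge 0}$ be a Brownian sheet, that is, a real-valued centered Gaussian process indexed by $\mathbb R_+\times\mathbb R_+$ with covariance $\mathbb E(W_{x,s}W_{y,t})=(x\wedge y)(s\wedge t)$. A random vector or process is called infinitely divisible if for every integer $n\ge 1$ it has the same law as a sum of $n$ independent identically distributed random vectors (respectively processes). (i) For all $(x_i,s_i)\in\mathbb R_+^2$, $1\le i\le 3$, the vector $(W_{x_i,s_i}^2)_{1\le i\le 3}$ is infinitely divisible. (ii) The process $(W_{x,s}^2)_{x\ge 0,\,s\ge 0}$ is not infinitely divisible. More precisely, there are four points $(x_i,s_i)\in\mathbb R_+^2$, $1\le i\le 4$, such that the covariance matrix $G=\big((x_i\wedge x_j)(s_i\wedge s_j)\big)_{1\le i,j\le 4}$ is nonsingular, $G^{-1}$ has a positive off-diagonal entry (so $G^{-1}$ is not an $M$-matrix, where an $M$-matrix is a nonsingular real matrix with nonpositive off-diagonal entries and entrywise nonnegative inverse), and the vector $(W_{x_i,s_i}^2)_{1\le i\le 4}$ is not infinitely divisible. -/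

import Mathlib

open MeasureTheory ProbabilityTheory
open scoped NNReal

/-- The covariance `((x, s), (y, t)) ↦ (x ∧ y) (s ∧ t)` of the Brownian sheet. -/
def sheetCov (p q : ℝ≥0 × ℝ≥0) : ℝ :=
  ((min p.1 q.1 : ℝ≥0) : ℝ) * ((min p.2 q.2 : ℝ≥0) : ℝ)

/-- A Brownian sheet: a centered real Gaussian process indexed by `ℝ₊ × ℝ₊`, whose covariance
is `(x ∧ y) (s ∧ t)`. -/
structure IsBrownianSheet {Ω : Type*} [MeasurableSpace Ω] (P : Measure Ω)
    (W : ℝ≥0 × ℝ≥0 → Ω → ℝ) : Prop where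
  measurable : ∀ p, Measurable (W p)
  gaussian : IsGaussianProcess W P
  centered : ∀ p, ∫ ω, W p ω ∂P = 0
  covariance : ∀ p q, ∫ ω, W p ω * W q ω ∂P = sheetCov p q

/-- A law `μ` is infinitely divisible if, for every `n ≥ 1`, it is the law of a sum of `n`
independent random elements with a common law `ν`. It is used for laws of random vectors
(`E = Fin k → ℝ`) and for laws of processes (`E = T → ℝ` with the product `σ`-algebra). -/
def IsInfinitelyDivisible {E : Type*} [MeasurableSpace E] [AddCommMonoid E]
    (μ : Measure E) : Prop :=
  ∀ n : ℕ, 1 ≤ n → ∃ ν : Measure E, IsProbabilityMeasure ν ∧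
    μ = (Measure.pi (fun _ : Fin n => ν)).map (fun y => ∑ k, y k)

/-- An `M`-matrix: nonpositive off-diagonal entries, nonsingular, entrywise nonnegative inverse. -/
def IsMMatrix {k : ℕ} (A : Matrix (Fin k) (Fin k) ℝ) : Prop :=
  (∀ i j, i ≠ j → A i j ≤ 0) ∧ IsUnit A.det ∧ ∀ i j, 0 ≤ A⁻¹ i j

open scoped ENNReal Matrix RealInnerProductSpace Topology BoundedContinuousFunction MatrixOrder

/-! For a Gaussian vector with covariance `G`, the squares have Laplace transform `det (1 + Λ H) ^
(-1/2)`, where `H = 2G` and `Λ = diag l`. Infinite divisibility thus amounts to its `n`-th roots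
being Laplace transforms too.

Three points: `det (1 + Λ H) = det H * det (H⁻¹ + Λ)`. If `H⁻¹` has nonpositive off-diagonal
entries, factoring out the diagonal of `H⁻¹ + Λ` leaves `1 - Q`, where `Q` is a polynomial with
nonnegative coefficients in transforms of exponential laws. The negative binomial series then shows
that every negative power of the determinant is a Laplace transform
(`isLaplaceTransform_det_rpow_neg`). The sign condition is `sheetCov_mul_sheetCov_le`, inherited
from the one-dimensional inequality for minima. Repeated points and points on the axes are images of
the nondegenerate case under additive maps.

Four points: if the law is infinitely divisible with Laplace transform `φ`, each `φ ^ (1/n)` has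
nonnegative alternating differences, hence so has `log φ = lim n (φ ^ (1/n) - 1)`
(`IsInfinitelyDivisible.sum_powerset_log_nonneg`). At the corners of a square one third-order
difference is negative. The process fails as well, since evaluation at these corners is additive. -/

/-- Infinite divisibility is preserved by measurable additive maps. -/
theorem IsInfinitelyDivisible.map {E F : Type*} [MeasurableSpace E] [AddCommMonoid E]
    [MeasurableAdd₂ E] [MeasurableSpace F] [AddCommMonoid F] [MeasurableAdd₂ F]
    {μ : Measure E} (hμ : IsInfinitelyDivisible μ) (f : E →+ F) (hf : Measurable f) :
    IsInfinitelyDivisible (μ.map f) := by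
  intro n hn
  obtain ⟨ν, hν, rfl⟩ := hμ n hn
  have : IsProbabilityMeasure (ν.map f) := Measure.isProbabilityMeasure_map hf.aemeasurable
  refine ⟨ν.map f, this, ?_⟩
  rw [← Measure.pi_map_pi (fun _ => hf.aemeasurable), Measure.map_map hf (by fun_prop),
    Measure.map_map (by fun_prop) (by fun_prop)]
  congr 1
  ext y
  simp

/-! ### Laplace transforms of measures on the orthant -/

section Laplace

variable {ι : Type*} [Fintype ι]

/-- The exponential `x ↦ exp (-⟨l, x⟩)` on the orthant. -/
noncomputable def expNeg (l x : ι → ℝ≥0) : ℝ := Real.exp (-∑ i, (l i : ℝ) * x i)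

/-- The Laplace transform of a measure on the orthant. -/
noncomputable def laplace (μ : Measure (ι → ℝ≥0)) (l : ι → ℝ≥0) : ℝ≥0∞ :=
  ∫⁻ x, ENNReal.ofReal (expNeg l x) ∂μ

theorem expNeg_nonneg (l x : ι → ℝ≥0) : 0 ≤ expNeg l x := (Real.exp_pos _).le

theorem expNeg_le_one (l x : ι → ℝ≥0) : expNeg l x ≤ 1 :=
  Real.exp_le_one_iff.2 (neg_nonpos.2 (Finset.sum_nonneg fun i _ => by positivity))

theorem expNeg_add_left (l m x : ι → ℝ≥0) : expNeg (l + m) x = expNeg l x * expNeg m x := by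
  simp only [expNeg, ← Real.exp_add, Pi.add_apply, NNReal.coe_add, add_mul,
    Finset.sum_add_distrib]
  congr 1; ring

theorem expNeg_add_right (l x y : ι → ℝ≥0) : expNeg l (x + y) = expNeg l x * expNeg l y := by
  simp only [expNeg, ← Real.exp_add, Pi.add_apply, NNReal.coe_add, mul_add,
    Finset.sum_add_distrib]
  congr 1; ring

theorem expNeg_zero_left (x : ι → ℝ≥0) : expNeg 0 x = 1 := by simp [expNeg]

theorem expNeg_sum_right (l : ι → ℝ≥0) {κ : Type*} (s : Finset κ) (y : κ → ι → ℝ≥0) :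
    expNeg l (∑ k ∈ s, y k) = ∏ k ∈ s, expNeg l (y k) := by
  classical
  induction s using Finset.induction_on with
  | empty => simp [expNeg]
  | insert a s ha ih => rw [Finset.sum_insert ha, Finset.prod_insert ha, expNeg_add_right, ih]

theorem continuous_expNeg (l : ι → ℝ≥0) : Continuous (expNeg l) := by
  unfold expNeg; fun_prop

@[fun_prop]
theorem measurable_expNeg (l : ι → ℝ≥0) : Measurable (expNeg l) :=
  (continuous_expNeg l).measurable

/-- `expNeg l` as a bounded continuous function. -/
noncomputable def expNegBCF (l : ι → ℝ≥0) : (ι → ℝ≥0) →ᵇ ℝ :=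
  BoundedContinuousFunction.ofNormedAddCommGroup (expNeg l) (continuous_expNeg l) 1 fun x => by
    rw [Real.norm_of_nonneg (expNeg_nonneg l x)]; exact expNeg_le_one l x

@[simp] theorem expNegBCF_apply (l x : ι → ℝ≥0) : expNegBCF l x = expNeg l x := rfl

/-- The exponentials, as a submonoid of the bounded continuous functions. -/
noncomputable def expNegSubmonoid (ι : Type*) [Fintype ι] :
    Submonoid ((ι → ℝ≥0) →ᵇ ℝ) where
  carrier := Set.range expNegBCF
  one_mem' := ⟨0, by ext x; simp [expNeg_zero_left]⟩
  mul_mem' := by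
    rintro _ _ ⟨l, rfl⟩ ⟨m, rfl⟩
    exact ⟨l + m, by ext x; simp [expNeg_add_left]⟩

/-- A finite measure on the orthant is determined by its Laplace transform. -/
theorem ext_of_laplace {μ ν : Measure (ι → ℝ≥0)} [IsFiniteMeasure μ] [IsFiniteMeasure ν]
    (h : ∀ l, laplace μ l = laplace ν l) : μ = ν := by
  have hint : ∀ l, ∫ x, expNeg l x ∂μ = ∫ x, expNeg l x ∂ν := by
    intro l
    rw [integral_eq_lintegral_of_nonneg_ae (.of_forall (expNeg_nonneg l)) (by fun_prop),
      integral_eq_lintegral_of_nonneg_ae (.of_forall (expNeg_nonneg l)) (by fun_prop)]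
    exact congrArg _ (h l)
  let A : StarSubalgebra ℝ ((ι → ℝ≥0) →ᵇ ℝ) :=
    { Algebra.adjoin ℝ (expNegSubmonoid ι : Set ((ι → ℝ≥0) →ᵇ ℝ)) with
      star_mem' := fun {f} hf => by
        have : star f = f := by ext x; simp
        rw [this]; exact hf }
  have hmem : ∀ l, expNegBCF l ∈ A := fun l => Algebra.subset_adjoin ⟨l, rfl⟩
  refine ext_of_forall_mem_subalgebra_integral_eq_of_pseudoEMetric_complete_countable
    (𝕜 := ℝ) (A := A) ?_ ?_
  · intro x y hxy
    obtain ⟨i, hi⟩ := Function.ne_iff.1 hxy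
    classical
    refine ⟨expNeg (Pi.single i 1), ⟨(expNegBCF (Pi.single i 1)).toContinuousMap,
      ⟨expNegBCF (Pi.single i 1), hmem _, rfl⟩, rfl⟩, ?_⟩
    intro he
    apply hi
    have : ∀ z : ι → ℝ≥0, expNeg (Pi.single i 1) z = Real.exp (-(z i : ℝ)) := by
      intro z
      simp only [expNeg]
      rw [Finset.sum_eq_single i]
      · simp
      · intro j _ hj; simp [hj]
      · simp
    rw [this, this, Real.exp_eq_exp, neg_inj] at he
    exact_mod_cast he
  · intro g hg
    -- A product of exponentials is an exponential, so the generated algebra is their linear span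
    -- and linearity of the integral suffices.
    have hg' : g ∈ Submodule.span ℝ (expNegSubmonoid ι : Set ((ι → ℝ≥0) →ᵇ ℝ)) := by
      have : g ∈ Subalgebra.toSubmodule
        (Algebra.adjoin ℝ (expNegSubmonoid ι : Set ((ι → ℝ≥0) →ᵇ ℝ))) := hg
      rwa [Algebra.adjoin_eq_span, Submonoid.closure_eq] at this
    clear hg
    induction hg' using Submodule.span_induction with
    | mem g hg =>
      obtain ⟨l, rfl⟩ := hg
      exact hint l
    | zero => simp
    | add f g _ _ hf hg =>
      simp only [BoundedContinuousFunction.coe_add, Pi.add_apply]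
      rw [integral_add (f.integrable _) (g.integrable _), integral_add (f.integrable _)
        (g.integrable _)]
      rw [hf, hg]
    | smul c g _ hg =>
      simp only [BoundedContinuousFunction.coe_smul]
      rw [integral_smul, integral_smul, hg]

/-- The Laplace transform of a sum of independent copies is a power. -/
theorem laplace_pi_sum (ν : Measure (ι → ℝ≥0)) [IsProbabilityMeasure ν] (n : ℕ) (l : ι → ℝ≥0) :
    laplace ((Measure.pi (fun _ : Fin n => ν)).map (fun y => ∑ k, y k)) l = laplace ν l ^ n := by
  rw [laplace, lintegral_map (by fun_prop) (by fun_prop)]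
  have hind : iIndepFun (fun (k : Fin n) (y : Fin n → ι → ℝ≥0) =>
      ENNReal.ofReal (expNeg l (y k))) (Measure.pi (fun _ : Fin n => ν)) :=
    iIndepFun_pi (X := fun _ x => ENNReal.ofReal (expNeg l x)) (fun _ => by fun_prop)
  simp only [expNeg_sum_right, ENNReal.ofReal_prod_of_nonneg (fun i _ => expNeg_nonneg l _)]
  rw [lintegral_prod_eq_prod_lintegral_of_indepFun _ _ hind (fun k => by fun_prop)]
  have : ∀ k : Fin n, ∫⁻ y : Fin n → ι → ℝ≥0, ENNReal.ofReal (expNeg l (y k))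
      ∂(Measure.pi (fun _ : Fin n => ν)) = laplace ν l := fun k =>
    (measurePreserving_eval (fun _ : Fin n => ν) k).lintegral_comp
      (f := fun x => ENNReal.ofReal (expNeg l x)) (by fun_prop)
  simp [this]

theorem laplace_zero (μ : Measure (ι → ℝ≥0)) : laplace μ 0 = μ Set.univ := by
  simp [laplace, expNeg_zero_left]

/-- A function that is the Laplace transform of some measure on the orthant. -/
def IsLaplaceTransform (f : (ι → ℝ≥0) → ℝ≥0∞) : Prop :=
  ∃ μ : Measure (ι → ℝ≥0), SFinite μ ∧ ∀ l, laplace μ l = f l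

namespace IsLaplaceTransform

variable {f g : (ι → ℝ≥0) → ℝ≥0∞}

theorem one : IsLaplaceTransform (fun _ : ι → ℝ≥0 => 1) :=
  ⟨Measure.dirac 0, inferInstance, fun l => by
    rw [laplace, lintegral_dirac' _ (by fun_prop)]; simp [expNeg]⟩

theorem mul (hf : IsLaplaceTransform f) (hg : IsLaplaceTransform g) :
    IsLaplaceTransform (fun l => f l * g l) := by
  obtain ⟨μ, hμ, h1⟩ := hf
  obtain ⟨ν, hν, h2⟩ := hg
  refine ⟨μ.conv ν, inferInstance, fun l => ?_⟩
  beta_reduce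
  rw [← h1, ← h2, laplace, Measure.lintegral_conv (by fun_prop)]
  simp only [expNeg_add_right, ENNReal.ofReal_mul (expNeg_nonneg _ _)]
  simp_rw [lintegral_const_mul _ (by fun_prop : Measurable fun x => ENNReal.ofReal (expNeg l x))]
  rw [lintegral_mul_const _ (by fun_prop)]
  rfl

theorem pow (hf : IsLaplaceTransform f) (n : ℕ) : IsLaplaceTransform (fun l => f l ^ n) := by
  induction n with
  | zero => simpa using one
  | succ n ih => simpa only [pow_succ] using ih.mul hf

/-- Values in `ℝ≥0∞` and s-finite measures make countable sums unconditional; finiteness is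
recovered at the end from the value at `0`. -/
theorem tsum {κ : Type*} [Countable κ] {f : κ → (ι → ℝ≥0) → ℝ≥0∞}
    (hf : ∀ k, IsLaplaceTransform (f k)) : IsLaplaceTransform (fun l => ∑' k, f k l) := by
  choose μ hμ h using hf
  refine ⟨Measure.sum μ, inferInstance, fun l => ?_⟩
  rw [laplace, lintegral_sum_measure]
  exact tsum_congr fun k => h k l

theorem add (hf : IsLaplaceTransform f) (hg : IsLaplaceTransform g) :
    IsLaplaceTransform (fun l => f l + g l) := by
  obtain ⟨μ, hμ, h1⟩ := hf
  obtain ⟨ν, hν, h2⟩ := hg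
  exact ⟨μ + ν, inferInstance, fun l => by
    beta_reduce; rw [laplace, lintegral_add_measure, ← h1, ← h2]; rfl⟩

theorem const_mul (hf : IsLaplaceTransform f) (c : ℝ≥0) :
    IsLaplaceTransform (fun l => (c : ℝ≥0∞) * f l) := by
  obtain ⟨μ, hμ, h1⟩ := hf
  exact ⟨(c : ℝ≥0∞) • μ, inferInstance, fun l => by
    beta_reduce; rw [laplace, lintegral_smul_measure, ← h1]; rfl⟩

end IsLaplaceTransform

/-- The Laplace transform of the gamma law. -/
theorem lintegral_exp_neg_gammaMeasure {a r : ℝ} (ha : 0 < a) (hr : 0 < r) {t : ℝ} (ht : 0 ≤ t) :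
    ∫⁻ x, ENNReal.ofReal (Real.exp (-(t * x))) ∂(gammaMeasure a r) =
      ENNReal.ofReal ((r / (r + t)) ^ a) := by
  have hrt : 0 < r + t := by positivity
  rw [gammaMeasure, lintegral_withDensity_eq_lintegral_mul _ (by unfold gammaPDF; fun_prop)
    (by fun_prop)]
  have : ∀ x, (gammaPDF a r * fun x => ENNReal.ofReal (Real.exp (-(t * x)))) x =
      ENNReal.ofReal ((r / (r + t)) ^ a) * gammaPDF a (r + t) x := by
    intro x
    rcases lt_or_ge x 0 with hx | hx
    · simp [gammaPDF_of_neg hx]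
    · rw [Pi.mul_apply, gammaPDF_of_nonneg hx, gammaPDF_of_nonneg hx,
        ← ENNReal.ofReal_mul (by positivity), ← ENNReal.ofReal_mul (by positivity),
        Real.div_rpow hr.le hrt.le]
      congr 1
      have h1 : (r + t) ^ a ≠ 0 := (Real.rpow_pos_of_pos hrt a).ne'
      have h2 : Real.exp (-((r + t) * x)) = Real.exp (-(r * x)) * Real.exp (-(t * x)) := by
        rw [← Real.exp_add]; congr 1; ring
      rw [h2]
      field_simp
  simp_rw [this]
  rw [lintegral_const_mul _ (by unfold gammaPDF; fun_prop), lintegral_gammaPDF_eq_one ha hrt,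
    mul_one]

/-- The function `(r / (r + l i)) ^ a` is the Laplace transform of a gamma law on the `i`-th axis. -/
theorem IsLaplaceTransform.gamma [DecidableEq ι] {a r : ℝ} (ha : 0 < a) (hr : 0 < r) (i : ι) :
    IsLaplaceTransform (fun l : ι → ℝ≥0 => ENNReal.ofReal ((r / (r + l i)) ^ a)) := by
  have := isProbabilityMeasure_gammaMeasure ha hr
  refine ⟨(gammaMeasure a r).map (fun x => Pi.single i x.toNNReal), inferInstance, fun l => ?_⟩
  have hm : Measurable (fun x : ℝ => (Pi.single i x.toNNReal : ι → ℝ≥0)) := by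
    refine measurable_pi_iff.2 fun j => ?_
    by_cases h : j = i
    · subst h; simpa using measurable_real_toNNReal
    · simp [h]
  beta_reduce
  rw [laplace, lintegral_map (by fun_prop) hm, ← lintegral_exp_neg_gammaMeasure ha hr (l i).coe_nonneg]
  refine lintegral_congr_ae ?_
  -- The truncation by `toNNReal` is harmless because the gamma law lives on the half-line.
  have h0 : ∀ᵐ x ∂(gammaMeasure a r), 0 ≤ x := by
    rw [ae_iff, gammaMeasure, withDensity_apply _ (by measurability)]
    simpa [Set.Iio] using lintegral_gammaPDF_of_nonpos (a := a) (r := r) le_rfl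
  filter_upwards [h0] with x hx
  rw [expNeg, Finset.sum_eq_single i]
  · simp [hx]
  · intro j _ hj; simp [hj]
  · simp

end Laplace

/-! ### Gaussian integrals and determinants -/

theorem integral_exp_neg_mul_sq_gaussianReal {d : ℝ} (hd : 0 ≤ d) :
    ∫ x, Real.exp (-(d * x ^ 2)) ∂(gaussianReal 0 1) = (1 + 2 * d) ^ (-(1 / 2) : ℝ) := by
  rw [integral_gaussianReal_eq_integral_smul one_ne_zero]
  have : ∀ x : ℝ, gaussianPDFReal 0 1 x • Real.exp (-(d * x ^ 2)) =
      (√(2 * Real.pi))⁻¹ * Real.exp (-(d + 1 / 2) * x ^ 2) := by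
    intro x
    rw [gaussianPDFReal, smul_eq_mul, mul_assoc, ← Real.exp_add]
    simp only [NNReal.coe_one, mul_one, sub_zero]
    congr 2; ring
  simp_rw [this]
  rw [integral_const_mul, integral_gaussian, ← Real.sqrt_inv, ← Real.sqrt_mul (by positivity),
    Real.rpow_neg (by positivity), ← Real.sqrt_eq_rpow, ← Real.sqrt_inv]
  congr 1
  field_simp
  ring

variable {k : ℕ}

/-- The Laplace transform of a quadratic form in independent standard Gaussian variables. -/
theorem integral_exp_neg_quadratic_stdGaussian {M : Matrix (Fin k) (Fin k) ℝ}
    (hM : M.PosSemidef) :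
    ∫ z, Real.exp (-(z ⬝ᵥ M *ᵥ z)) ∂(stdGaussian (EuclideanSpace ℝ (Fin k))) =
      (1 + (2 : ℝ) • M).det ^ (-(1 / 2) : ℝ) := by
  have hH := hM.isHermitian
  set b := hH.eigenvectorBasis
  have hquad : ∀ x : Fin k → ℝ,
      ((∑ i, x i • b i : EuclideanSpace ℝ (Fin k)) : Fin k → ℝ) ⬝ᵥ
        M *ᵥ ((∑ i, x i • b i : EuclideanSpace ℝ (Fin k)) : Fin k → ℝ) =
      ∑ i, hH.eigenvalues i * x i ^ 2 := by
    intro x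
    have h1 : ∀ u v : EuclideanSpace ℝ (Fin k), (u : Fin k → ℝ) ⬝ᵥ (v : Fin k → ℝ) = ⟪u, v⟫ := by
      intro u v
      simp [PiLp.inner_apply, dotProduct, mul_comm]
    have h2 : M *ᵥ ((∑ i, x i • b i : EuclideanSpace ℝ (Fin k)) : Fin k → ℝ) =
        ((∑ i, (hH.eigenvalues i * x i) • b i : EuclideanSpace ℝ (Fin k)) : Fin k → ℝ) := by
      simp only [WithLp.ofLp_sum, WithLp.ofLp_smul, Matrix.mulVec_sum, Matrix.mulVec_smul]
      refine Finset.sum_congr rfl fun i _ => ?_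
      rw [hH.mulVec_eigenvectorBasis, smul_smul, mul_comm]
    rw [h2, h1, b.orthonormal.inner_sum]
    exact Finset.sum_congr rfl fun i _ => by simp; ring
  -- In the eigenbasis of `M` the standard Gaussian still has independent standard coordinates, so
  -- the integral factors.
  rw [stdGaussian_eq_map_pi_orthonormalBasis b, integral_map (Measurable.aemeasurable (by fun_prop))
    (Continuous.aestronglyMeasurable (by fun_prop))]
  simp_rw [hquad, ← Finset.sum_neg_distrib, Real.exp_sum]
  rw [integral_fintype_prod_eq_prod (f := fun i x => Real.exp (-(hH.eigenvalues i * x ^ 2)))]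
  simp_rw [integral_exp_neg_mul_sq_gaussianReal (hM.eigenvalues_nonneg _)]
  rw [Real.finsetProd_rpow]
  · congr 1
    have hdet : (1 + (2 : ℝ) • M) = (hH.eigenvectorUnitary : Matrix (Fin k) (Fin k) ℝ) *
        Matrix.diagonal (fun i => 1 + 2 * hH.eigenvalues i) *
        star (hH.eigenvectorUnitary : Matrix (Fin k) (Fin k) ℝ) := by
      conv_lhs => rw [hH.spectral_theorem]
      have h3 : Matrix.diagonal (fun i => 1 + 2 * hH.eigenvalues i) =
          1 + (2 : ℝ) • Matrix.diagonal hH.eigenvalues := by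
        ext i j
        by_cases h : i = j
        · subst h; simp
        · simp [h]
      rw [h3, mul_add, add_mul, mul_one, Unitary.mul_star_self_of_mem hH.eigenvectorUnitary.2]
      simp [Unitary.conjStarAlgAut_apply]
    rw [hdet, Matrix.det_mul_comm, ← mul_assoc,
      Unitary.star_mul_self_of_mem hH.eigenvectorUnitary.2, one_mul,
      Matrix.det_diagonal]
  · intro i _
    have := hM.eigenvalues_nonneg i
    positivity

/-- The Laplace transform of the squares of the coordinates of a Gaussian vector. -/
theorem integral_exp_neg_sq_multivariateGaussian {G : Matrix (Fin k) (Fin k) ℝ}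
    (hG : G.PosSemidef) {l : Fin k → ℝ} (hl : ∀ i, 0 ≤ l i) :
    ∫ z, Real.exp (-∑ i, l i * z i ^ 2) ∂(multivariateGaussian 0 G) =
      (1 + Matrix.diagonal l * ((2 : ℝ) • G)).det ^ (-(1 / 2) : ℝ) := by
  set A := CFC.sqrt G with hA
  have hAA : A * A = G := CFC.sqrt_mul_sqrt_self _ hG.nonneg
  have hAH : A.IsHermitian := (CFC.sqrt_nonneg G).isSelfAdjoint
  have hAT : Aᵀ = A := by simpa [Matrix.IsHermitian] using hAH
  have hMps : (A * Matrix.diagonal l * A).PosSemidef := by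
    have := (Matrix.PosSemidef.diagonal (d := l) hl).mul_mul_conjTranspose_same A
    rwa [hAH.eq] at this
  rw [multivariateGaussian, integral_map (by fun_prop)
    (Continuous.aestronglyMeasurable (by fun_prop))]
  have hq : ∀ z : EuclideanSpace ℝ (Fin k),
      ∑ i, l i * (0 + Matrix.toEuclideanCLM (𝕜 := ℝ) A z : EuclideanSpace ℝ (Fin k)) i ^ 2 =
        z ⬝ᵥ (A * Matrix.diagonal l * A) *ᵥ z := by
    intro z
    rw [← Matrix.mulVec_mulVec, ← Matrix.mulVec_mulVec, Matrix.dotProduct_mulVec,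
      ← Matrix.mulVec_transpose, hAT, dotProduct]
    refine Finset.sum_congr rfl fun i _ => ?_
    simp [Matrix.mulVec_diagonal]
    ring
  simp_rw [← hA, hq]
  rw [integral_exp_neg_quadratic_stdGaussian hMps, ← Matrix.mul_smul, ← hAA]
  congr 1
  -- Sylvester's identity `det (1 + XY) = det (1 + YX)` reunites the two square roots of `G`.
  rw [mul_assoc, ← Matrix.det_one_add_mul_comm]
  simp [mul_assoc]

/-- By Sylvester's identity this is the determinant of `1 + √G Λ √G`, which is positive definite. -/
theorem Matrix.PosSemidef.det_one_add_diagonal_mul_pos {G : Matrix (Fin k) (Fin k) ℝ}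
    (hG : G.PosSemidef) {l : Fin k → ℝ} (hl : ∀ i, 0 ≤ l i) :
    0 < (1 + Matrix.diagonal l * G).det := by
  set A := CFC.sqrt G
  have hAA : A * A = G := CFC.sqrt_mul_sqrt_self _ hG.nonneg
  have hAH : A.IsHermitian := (CFC.sqrt_nonneg G).isSelfAdjoint
  have hMps : (A * Matrix.diagonal l * A).PosSemidef := by
    have := (Matrix.PosSemidef.diagonal (d := l) hl).mul_mul_conjTranspose_same A
    rwa [hAH.eq] at this
  have := (Matrix.PosDef.one.add_posSemidef hMps).det_pos
  rwa [mul_assoc, Matrix.det_one_add_mul_comm, mul_assoc, hAA] at this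

/-! ### Covariance of the sheet -/

/-- The covariance matrix of the Brownian sheet at finitely many points. -/
noncomputable def sheetGram {k : ℕ} (p : Fin k → ℝ≥0 × ℝ≥0) : Matrix (Fin k) (Fin k) ℝ :=
  Matrix.of fun i j => sheetCov (p i) (p j)

theorem sheetCov_comm (p q : ℝ≥0 × ℝ≥0) : sheetCov p q = sheetCov q p := by
  simp only [sheetCov, min_comm]

theorem min_mul_min_le_min_mul (a b c : ℝ≥0) : min a c * min b c ≤ min a b * c := by
  rcases le_total a b with h | h
  · rw [min_eq_left h]; exact mul_le_mul' (min_le_left _ _) (min_le_right _ _)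
  · rw [min_eq_right h, mul_comm]; exact mul_le_mul' (min_le_left _ _) (min_le_right _ _)

/-- The inequality for minima is multiplied over the two coordinates. It says that `W p` and `W q`
are nonnegatively correlated given `W r`, which fixes the signs of the off-diagonal cofactors of a
`3 × 3` covariance matrix. -/
theorem sheetCov_mul_sheetCov_le (p q r : ℝ≥0 × ℝ≥0) :
    sheetCov p r * sheetCov q r ≤ sheetCov p q * sheetCov r r := by
  have h := mul_le_mul' (min_mul_min_le_min_mul p.1 q.1 r.1) (min_mul_min_le_min_mul p.2 q.2 r.2)
  have h' : ((min p.1 r.1 * min q.1 r.1 * (min p.2 r.2 * min q.2 r.2) : ℝ≥0) : ℝ) ≤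
      ((min p.1 q.1 * r.1 * (min p.2 q.2 * r.2) : ℝ≥0) : ℝ) := by exact_mod_cast h
  push_cast at h'
  simp only [sheetCov, min_self, NNReal.coe_min] at h' ⊢
  linarith

/-- The covariances with the points `p i` are linearly independent functions when the `p i` are
distinct and off the axes. -/
theorem eq_zero_of_sum_mul_sheetCov_eq_zero {ι : Type*} [Fintype ι] {p : ι → ℝ≥0 × ℝ≥0}
    (hinj : Function.Injective p) (hpos : ∀ i, 0 < (p i).1 ∧ 0 < (p i).2) {c : ι → ℝ}
    (hc : ∀ q, ∑ i, c i * sheetCov (p i) q = 0) : c = 0 := by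
  classical
  by_contra hne
  obtain ⟨i₀, hi₀⟩ := Function.ne_iff.1 hne
  -- The sum is tested on the increment over a small rectangle with upper corner `p i`, the
  -- lexicographically largest point carrying a nonzero coefficient. No coordinate of the points
  -- lies strictly between `a` or `b` and the matching coordinate of `p i`, so every other term
  -- vanishes.
  obtain ⟨i, hi, hmax⟩ := (Finset.univ.filter fun i => c i ≠ 0).exists_max_image
    (fun i => toLex (p i)) ⟨i₀, by simpa using hi₀⟩
  have hi : c i ≠ 0 := by simpa using hi
  have hbelow : ∀ (f : ι → ℝ≥0) (t : ℝ≥0), 0 < t → ∃ a < t, ∀ j, f j < t → f j ≤ a := by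
    intro f t ht
    refine ⟨(Finset.univ.filter fun j => f j < t).sup f, ?_, fun j hj => ?_⟩
    · rw [Finset.sup_lt_iff (by simpa using ht)]
      simp
    · exact Finset.le_sup (f := f) (by simpa using hj)
  obtain ⟨a, ha, ha'⟩ := hbelow (fun j => (p j).1) (p i).1 (hpos i).1
  obtain ⟨b, hb, hb'⟩ := hbelow (fun j => (p j).2) (p i).2 (hpos i).2
  have hdiff : ∑ j, c j * (sheetCov (p j) (p i) - sheetCov (p j) (a, (p i).2) -
      sheetCov (p j) ((p i).1, b) + sheetCov (p j) (a, b)) = 0 := by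
    simp only [mul_add, mul_sub, Finset.sum_add_distrib, Finset.sum_sub_distrib, hc]
    simp
  have hfac : ∀ j, sheetCov (p j) (p i) - sheetCov (p j) (a, (p i).2) -
      sheetCov (p j) ((p i).1, b) + sheetCov (p j) (a, b) =
      (((min (p j).1 (p i).1 : ℝ≥0) : ℝ) - (min (p j).1 a : ℝ≥0)) *
        (((min (p j).2 (p i).2 : ℝ≥0) : ℝ) - (min (p j).2 b : ℝ≥0)) := by
    intro j; simp only [sheetCov]; ring
  rw [Finset.sum_eq_single i] at hdiff
  · rw [hfac, min_self, min_self, min_eq_right ha.le, min_eq_right hb.le] at hdiff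
    have h1 : (0 : ℝ) < (p i).1 - a := sub_pos.2 (by exact_mod_cast ha)
    have h2 : (0 : ℝ) < (p i).2 - b := sub_pos.2 (by exact_mod_cast hb)
    exact (mul_ne_zero hi (mul_pos h1 h2).ne') hdiff
  · intro j _ hji
    by_cases hcj : c j = 0
    · simp [hcj]
    have hle : toLex (p j) ≤ toLex (p i) := hmax j (by simpa using hcj)
    have hlt : toLex (p j) < toLex (p i) :=
      lt_of_le_of_ne hle fun h => hji (hinj (toLex.injective h))
    rw [hfac]
    rcases (Prod.Lex.toLex_lt_toLex).1 hlt with h | ⟨h1, h2⟩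
    · rw [min_eq_left h.le, min_eq_left (ha' j h)]; simp
    · rw [min_eq_left h2.le, min_eq_left (hb' j h2)]; simp
  · simp

/-! ### Finite-dimensional laws of the sheet -/

namespace IsBrownianSheet

variable {Ω : Type*} [MeasurableSpace Ω] {P : Measure Ω}
  {W : ℝ≥0 × ℝ≥0 → Ω → ℝ}

theorem memLp_two (hW : IsBrownianSheet P W) (p : ℝ≥0 × ℝ≥0) : MemLp (W p) 2 P :=
  (hW.gaussian.hasGaussianLaw_eval p).memLp_two

theorem integrable_mul (hW : IsBrownianSheet P W) (p q : ℝ≥0 × ℝ≥0) :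
    Integrable (fun ω => W p ω * W q ω) P :=
  (hW.memLp_two p).integrable_mul (hW.memLp_two q)

theorem integral_sum_mul (hW : IsBrownianSheet P W) {k : ℕ} (p : Fin k → ℝ≥0 × ℝ≥0)
    (c : Fin k → ℝ) (q : ℝ≥0 × ℝ≥0) :
    ∫ ω, (∑ i, c i * W (p i) ω) * W q ω ∂P = ∑ i, c i * sheetCov (p i) q := by
  simp_rw [Finset.sum_mul, mul_assoc]
  rw [integral_finsetSum _ fun i _ => (hW.integrable_mul _ _).const_mul _]
  simp_rw [integral_const_mul, hW.covariance]

theorem integral_sum_sq (hW : IsBrownianSheet P W) {k : ℕ} (p : Fin k → ℝ≥0 × ℝ≥0)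
    (c : Fin k → ℝ) :
    ∫ ω, (∑ i, c i * W (p i) ω) ^ 2 ∂P = c ⬝ᵥ sheetGram p *ᵥ c := by
  have h : ∀ ω, (∑ i, c i * W (p i) ω) ^ 2 =
      ∑ j, c j * ((∑ i, c i * W (p i) ω) * W (p j) ω) := by
    intro ω
    rw [sq]
    conv_lhs => rw [Finset.mul_sum]
    exact Finset.sum_congr rfl fun j _ => by ring
  simp_rw [h]
  rw [integral_finsetSum]
  · simp_rw [integral_const_mul, hW.integral_sum_mul, dotProduct, Matrix.mulVec, dotProduct]
    refine Finset.sum_congr rfl fun j _ => ?_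
    congr 1
    refine Finset.sum_congr rfl fun i _ => ?_
    rw [sheetGram, Matrix.of_apply, sheetCov_comm, mul_comm]
  · intro j _
    refine Integrable.const_mul ?_ _
    simp_rw [Finset.sum_mul, mul_assoc]
    exact integrable_finsetSum _ fun i _ => (hW.integrable_mul _ _).const_mul _

theorem isHermitian_sheetGram {k : ℕ} (p : Fin k → ℝ≥0 × ℝ≥0) : (sheetGram p).IsHermitian := by
  ext i j
  simp [sheetGram, sheetCov_comm]

theorem posSemidef (hW : IsBrownianSheet P W) {k : ℕ} (p : Fin k → ℝ≥0 × ℝ≥0) :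
    (sheetGram p).PosSemidef := by
  refine Matrix.PosSemidef.of_dotProduct_mulVec_nonneg (isHermitian_sheetGram p) fun c => ?_
  rw [star_trivial, ← hW.integral_sum_sq]
  exact integral_nonneg fun ω => sq_nonneg _

/-- A null vector `c` makes `∑ c i * W (p i)` vanish almost surely, hence uncorrelated with `W q`
for every `q`, not only for the `p i`. Independence of the covariance functions then gives `c = 0`.
-/
theorem posDef (hW : IsBrownianSheet P W) {k : ℕ} {p : Fin k → ℝ≥0 × ℝ≥0}
    (hinj : Function.Injective p) (hpos : ∀ i, 0 < (p i).1 ∧ 0 < (p i).2) :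
    (sheetGram p).PosDef := by
  refine Matrix.PosDef.of_dotProduct_mulVec_pos (isHermitian_sheetGram p) fun c hc => ?_
  rw [star_trivial, ← hW.integral_sum_sq]
  refine lt_of_le_of_ne (integral_nonneg fun ω => sq_nonneg _) fun h => hc ?_
  have hmem : MemLp (fun ω => ∑ i, c i * W (p i) ω) 2 P :=
    memLp_finsetSum _ fun i _ => (hW.memLp_two _).const_mul _
  have h0 := (integral_eq_zero_iff_of_nonneg (fun ω => sq_nonneg _) hmem.integrable_sq).1 h.symm
  refine eq_zero_of_sum_mul_sheetCov_eq_zero hinj hpos fun q => ?_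
  rw [← hW.integral_sum_mul]
  refine integral_eq_zero_of_ae ?_
  filter_upwards [h0] with ω hω
  have : ∑ i, c i * W (p i) ω = 0 := by simpa using hω
  simp [this]

theorem ae_eq_zero (hW : IsBrownianSheet P W) {p : ℝ≥0 × ℝ≥0} (hp : ¬ (0 < p.1 ∧ 0 < p.2)) :
    W p =ᵐ[P] 0 := by
  have h : ∫ ω, W p ω ^ 2 ∂P = 0 := by
    simp_rw [sq, hW.covariance, sheetCov, min_self]
    simp only [not_and_or, not_lt, nonpos_iff_eq_zero] at hp
    rcases hp with hp | hp <;> simp [hp]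
  have h0 := (integral_eq_zero_iff_of_nonneg (fun ω => sq_nonneg _) (hW.memLp_two p).integrable_sq).1 h
  filter_upwards [h0] with ω hω
  simpa using hω

theorem map_eq_multivariateGaussian [IsProbabilityMeasure P] (hW : IsBrownianSheet P W) {k : ℕ}
    (p : Fin k → ℝ≥0 × ℝ≥0) :
    P.map (fun ω => WithLp.toLp 2 fun i => W (p i) ω) = multivariateGaussian 0 (sheetGram p) := by
  have hproc : IsGaussianProcess (fun i => W (p i)) P := hW.gaussian.comp_right p
  have hlaw : HasGaussianLaw (fun ω i => W (p i) ω) P := by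
    let L : (↥(Finset.univ : Finset (Fin k)) → ℝ) →L[ℝ] (Fin k → ℝ) :=
      ContinuousLinearMap.pi fun i => ContinuousLinearMap.proj ⟨i, Finset.mem_univ i⟩
    exact (hproc.hasGaussianLaw Finset.univ).map L
  have hlaw2 : HasGaussianLaw (fun ω => WithLp.toLp 2 fun i => W (p i) ω) P := hlaw.toLp_pi 2
  have := hlaw2.isGaussian_map
  have hmeas : Measurable (fun ω => WithLp.toLp 2 fun i => W (p i) ω) := by
    have := hW.measurable
    fun_prop
  apply IsGaussian.ext
  · rw [integral_id_multivariateGaussian', integral_map hmeas.aemeasurable (by fun_prop)]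
    ext i
    have hint : Integrable (fun ω => WithLp.toLp 2 fun i => W (p i) ω) P := hlaw2.integrable
    have := (EuclideanSpace.proj (𝕜 := ℝ) i).integral_comp_comm hint
    simp only [id_eq]
    simpa [hW.centered] using this.symm
  · rw [← ContinuousLinearMap.toBilinForm_inj]
    refine LinearMap.BilinForm.ext_basis (EuclideanSpace.basisFun (Fin k) ℝ).toBasis fun i j => ?_
    rw [ContinuousLinearMap.toBilinForm_apply, ContinuousLinearMap.toBilinForm_apply]
    simp only [OrthonormalBasis.coe_toBasis]
    rw [covarianceBilin_apply_basisFun (fun i => hW.memLp_two (p i)),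
      covarianceBilin_multivariateGaussian (hW.posSemidef p),
      covariance_eq_sub (hW.memLp_two _) (hW.memLp_two _)]
    simp [hW.centered, hW.covariance, sheetGram]

/-- The Laplace transform of the squared sheet at finitely many points. -/
theorem integral_exp_neg_sq [IsProbabilityMeasure P] (hW : IsBrownianSheet P W) {k : ℕ}
    (p : Fin k → ℝ≥0 × ℝ≥0) {l : Fin k → ℝ} (hl : ∀ i, 0 ≤ l i) :
    ∫ ω, Real.exp (-∑ i, l i * W (p i) ω ^ 2) ∂P =
      (1 + Matrix.diagonal l * ((2 : ℝ) • sheetGram p)).det ^ (-(1 / 2) : ℝ) := by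
  rw [← integral_exp_neg_sq_multivariateGaussian (hW.posSemidef p) hl,
    ← hW.map_eq_multivariateGaussian, integral_map _ (Continuous.aestronglyMeasurable (by fun_prop))]
  have := hW.measurable
  exact Measurable.aemeasurable (by fun_prop)

end IsBrownianSheet

/-! ### Negative powers of three-dimensional determinants -/

/-- The coefficient is the rising factorial `β (β + 1) ⋯ (β + n - 1)` divided by `n!`. -/
theorem Ring.choose_add_sub_one_nonneg {β : ℝ} (hβ : 0 < β) (n : ℕ) :
    0 ≤ Ring.choose (β + n - 1) n := by
  have h := Ring.factorial_nsmul_multichoose_eq_ascPochhammer β n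
  rw [Ring.multichoose_eq, Polynomial.ascPochhammer_smeval_eq_eval] at h
  have h2 := ascPochhammer_pos n β hβ
  rw [← h, nsmul_eq_mul] at h2
  exact (pos_of_mul_pos_right h2 (by positivity)).le

theorem ofReal_one_sub_rpow_neg {β x : ℝ} (hβ : 0 < β) (hx : 0 ≤ x) (hx1 : x < 1) :
    ENNReal.ofReal ((1 - x) ^ (-β)) =
      ∑' n : ℕ, (Real.toNNReal (Ring.choose (β + n - 1) n) : ℝ≥0∞) * ENNReal.ofReal x ^ n := by
  have h := (Real.one_div_one_sub_rpow_hasFPowerSeriesOnBall_zero β).hasSum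
    (y := x) (by simpa [abs_of_nonneg hx, ← ofReal_norm] using hx1)
  have h' : HasSum (fun n : ℕ => Ring.choose (β + n - 1) n * x ^ n) ((1 - x) ^ (-β)) := by
    rw [Real.rpow_neg (by linarith), ← one_div]
    simpa [FormalMultilinearSeries.ofScalars_apply_eq, mul_comm] using h
  rw [← h'.tsum_eq, ENNReal.ofReal_tsum_of_nonneg _ h'.summable]
  · refine tsum_congr fun n => ?_
    rw [ENNReal.ofReal_mul (Ring.choose_add_sub_one_nonneg hβ n), ENNReal.ofReal_pow hx]
    rfl
  · intro n
    have := Ring.choose_add_sub_one_nonneg hβ n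
    positivity

/-- The negative binomial series writes this as a combination of powers of `f` with nonnegative
coefficients. -/
theorem IsLaplaceTransform.one_sub_rpow_neg {ι : Type*} [Fintype ι] {f : (ι → ℝ≥0) → ℝ}
    (hf : IsLaplaceTransform fun l => ENNReal.ofReal (f l)) (h0 : ∀ l, 0 ≤ f l)
    (h1 : ∀ l, f l < 1) {β : ℝ} (hβ : 0 < β) :
    IsLaplaceTransform fun l => ENNReal.ofReal ((1 - f l) ^ (-β)) := by
  simp_rw [ofReal_one_sub_rpow_neg hβ (h0 _) (h1 _)]
  exact .tsum fun n => (hf.pow n).const_mul _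

/-- If the off-diagonal entries of the inverse of a three-dimensional nonnegative positive definite
matrix `H` are nonpositive, then all negative powers of `det (1 + diag l * H)` are Laplace
transforms. -/
theorem isLaplaceTransform_det_rpow_neg {H : Matrix (Fin 3) (Fin 3) ℝ} (hH : H.PosDef)
    (hle : ∀ i j k, H i k * H j k ≤ H i j * H k k)
    {β : ℝ} (hβ : 0 < β) :
    IsLaplaceTransform fun l : Fin 3 → ℝ≥0 => ENNReal.ofReal
      ((1 + Matrix.diagonal (fun i => (l i : ℝ)) * H).det ^ (-β)) := by
  have hsymm : ∀ i j, H i j = H j i := fun i j => by simpa using (hH.isHermitian.apply j i)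
  obtain ⟨a, ha⟩ : ∃ a, a = H 0 0 := ⟨_, rfl⟩
  obtain ⟨b, hb⟩ : ∃ b, b = H 1 1 := ⟨_, rfl⟩
  obtain ⟨c, hc⟩ : ∃ c, c = H 2 2 := ⟨_, rfl⟩
  obtain ⟨d, hd⟩ : ∃ d, d = H 0 1 := ⟨_, rfl⟩
  obtain ⟨e, he⟩ : ∃ e, e = H 0 2 := ⟨_, rfl⟩
  obtain ⟨f, hf⟩ : ∃ f, f = H 1 2 := ⟨_, rfl⟩
  have hminor : ∀ i j : Fin 3, i ≠ j → 0 < H i i * H j j - H i j ^ 2 := by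
    intro i j hij
    have hinj : Function.Injective ![i, j] := by
      intro x y; fin_cases x <;> fin_cases y <;> simp [hij, hij.symm]
    have := (hH.submatrix hinj).det_pos
    rw [Matrix.det_fin_two] at this
    simp [hsymm j i] at this
    nlinarith
  obtain ⟨m0, hm0⟩ : ∃ m, m = b * c - f ^ 2 := ⟨_, rfl⟩
  obtain ⟨m1, hm1⟩ : ∃ m, m = a * c - e ^ 2 := ⟨_, rfl⟩
  obtain ⟨m2, hm2⟩ : ∃ m, m = a * b - d ^ 2 := ⟨_, rfl⟩
  have pm0 : 0 < m0 := by rw [hm0, hb, hc, hf]; exact hminor 1 2 (by decide)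
  have pm1 : 0 < m1 := by rw [hm1, ha, hc, he]; exact hminor 0 2 (by decide)
  have pm2 : 0 < m2 := by rw [hm2, ha, hb, hd]; exact hminor 0 1 (by decide)
  obtain ⟨D, hD⟩ : ∃ D, D = a * b * c + 2 * d * e * f - a * f ^ 2 - b * e ^ 2 - c * d ^ 2 :=
    ⟨_, rfl⟩
  have pD : 0 < D := by
    have := hH.det_pos
    rw [Matrix.det_fin_three, hsymm 1 0, hsymm 2 0, hsymm 2 1, ← ha, ← hb, ← hc, ← hd, ← he,
      ← hf] at this
    rw [hD]; linarith
  -- The off-diagonal entries of `H⁻¹` are `-x / D`, `-y / D` and `-z / D`.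
  obtain ⟨x, hx⟩ : ∃ x, x = d * c - e * f := ⟨_, rfl⟩
  obtain ⟨y, hy⟩ : ∃ y, y = e * b - d * f := ⟨_, rfl⟩
  obtain ⟨z, hz⟩ : ∃ z, z = f * a - d * e := ⟨_, rfl⟩
  have px : 0 ≤ x := by rw [hx, hd, hc, he, hf]; linarith [hle 0 1 2]
  have py : 0 ≤ y := by rw [hy, he, hb, hd, hf, hsymm 1 2]; linarith [hle 0 2 1]
  have pz : 0 ≤ z := by
    rw [hz, hf, ha, hd, he, hsymm 0 1, hsymm 0 2]; linarith [hle 1 2 0]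
  have hdet : ∀ l : Fin 3 → ℝ≥0, (1 + Matrix.diagonal (fun i => (l i : ℝ)) * H).det =
      1 + l 0 * a + l 1 * b + l 2 * c + l 0 * l 1 * m2 + l 0 * l 2 * m1 + l 1 * l 2 * m0 +
        l 0 * l 1 * l 2 * D := by
    intro l
    rw [Matrix.det_fin_three]
    simp only [Matrix.add_apply, Matrix.one_apply, Matrix.diagonal_mul, hsymm 1 0, hsymm 2 0,
      hsymm 2 1, ← ha, ← hb, ← hc, ← hd, ← he, ← hf, hm0, hm1, hm2, hD]
    simp
    ring
  have hpos : ∀ l : Fin 3 → ℝ≥0, 0 < (1 + Matrix.diagonal (fun i => (l i : ℝ)) * H).det := by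
    exact fun l => hH.posSemidef.det_one_add_diagonal_mul_pos fun i => (l i).coe_nonneg
  -- The diagonal of `H⁻¹ + Λ` is `m_i / D + l i`; `s_i` is its inverse, normalized to be the
  -- transform of an exponential law.
  set s0 : (Fin 3 → ℝ≥0) → ℝ := fun l => (m0 / D) / (m0 / D + l 0) with hs0
  set s1 : (Fin 3 → ℝ≥0) → ℝ := fun l => (m1 / D) / (m1 / D + l 1) with hs1
  set s2 : (Fin 3 → ℝ≥0) → ℝ := fun l => (m2 / D) / (m2 / D + l 2) with hs2
  have ps0 : ∀ l, 0 < s0 l := fun l => by positivity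
  have ps1 : ∀ l, 0 < s1 l := fun l => by positivity
  have ps2 : ∀ l, 0 < s2 l := fun l => by positivity
  set Q : (Fin 3 → ℝ≥0) → ℝ := fun l =>
    x ^ 2 / (m0 * m1) * (s0 l * s1 l) + y ^ 2 / (m0 * m2) * (s0 l * s2 l) +
      z ^ 2 / (m1 * m2) * (s1 l * s2 l) +
      2 * x * y * z / (m0 * m1 * m2) * (s0 l * s1 l * s2 l) with hQ
  have pQ : ∀ l, 0 ≤ Q l := fun l => by
    have := ps0 l
    have := ps1 l
    have := ps2 l
    positivity
  -- This is the expansion of `D * det (H⁻¹ + Λ)` after division by the diagonal entries.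
  have hfac : ∀ l : Fin 3 → ℝ≥0, (1 + Matrix.diagonal (fun i => (l i : ℝ)) * H).det *
      (s0 l * s1 l * s2 l) = m0 * m1 * m2 / D ^ 2 * (1 - Q l) := by
    intro l
    rw [hdet]
    have e0 : s0 l = m0 / (m0 + D * l 0) := by simp only [hs0]; field_simp
    have e1 : s1 l = m1 / (m1 + D * l 1) := by simp only [hs1]; field_simp
    have e2 : s2 l = m2 / (m2 + D * l 2) := by simp only [hs2]; field_simp
    have u0 : 0 < m0 + D * l 0 := by positivity
    have u1 : 0 < m1 + D * l 1 := by positivity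
    have u2 : 0 < m2 + D * l 2 := by positivity
    simp only [hQ]
    rw [e0, e1, e2]
    field_simp
    rw [hm0, hm1, hm2, hx, hy, hz, hD]
    ring
  -- Convergence of the series needs no estimate of `Q`: positivity of the determinant forces it.
  have hQ1 : ∀ l, Q l < 1 := by
    intro l
    have h1 := hfac l
    have h2 : 0 < m0 * m1 * m2 / D ^ 2 * (1 - Q l) := by
      rw [← h1]
      exact mul_pos (hpos l) (mul_pos (mul_pos (ps0 l) (ps1 l)) (ps2 l))
    have := pos_of_mul_pos_right h2 (by positivity)
    linarith
  have hpow : ∀ l : Fin 3 → ℝ≥0,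
      (1 + Matrix.diagonal (fun i => (l i : ℝ)) * H).det ^ (-β) =
      (m0 * m1 * m2 / D ^ 2) ^ (-β) *
        (s0 l ^ β * s1 l ^ β * s2 l ^ β * (1 - Q l) ^ (-β)) := by
    intro l
    have q1 : 0 < 1 - Q l := sub_pos.2 (hQ1 l)
    have p0 := ps0 l
    have p1 := ps1 l
    have p2 := ps2 l
    have : (1 + Matrix.diagonal (fun i => (l i : ℝ)) * H).det =
        m0 * m1 * m2 / D ^ 2 * ((s0 l * s1 l * s2 l)⁻¹ * (1 - Q l)) := by
      rw [mul_left_comm, ← hfac]; field_simp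
    rw [this, Real.mul_rpow (by positivity) (by positivity),
      Real.mul_rpow (by positivity) (by positivity), Real.inv_rpow (by positivity),
      Real.rpow_neg (x := s0 l * s1 l * s2 l) (by positivity), inv_inv,
      Real.mul_rpow (by positivity) (by positivity),
      Real.mul_rpow (by positivity) (by positivity)]
  have G : ∀ {γ r : ℝ} (_ : 0 < γ) (_ : 0 < r) (i : Fin 3),
      IsLaplaceTransform (fun l : Fin 3 → ℝ≥0 => ENNReal.ofReal ((r / (r + l i)) ^ γ)) :=
    fun hγ hr i => .gamma hγ hr i
  have r0 : 0 < m0 / D := by positivity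
  have r1 : 0 < m1 / D := by positivity
  have r2 : 0 < m2 / D := by positivity
  have S0 : IsLaplaceTransform fun l => ENNReal.ofReal (s0 l) := by
    simpa only [Real.rpow_one] using G one_pos r0 0
  have S1 : IsLaplaceTransform fun l => ENNReal.ofReal (s1 l) := by
    simpa only [Real.rpow_one] using G one_pos r1 1
  have S2 : IsLaplaceTransform fun l => ENNReal.ofReal (s2 l) := by
    simpa only [Real.rpow_one] using G one_pos r2 2
  have LQ : IsLaplaceTransform fun l => ENNReal.ofReal (Q l) := by
    have h := ((((S0.mul S1).const_mul (x ^ 2 / (m0 * m1)).toNNReal).add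
      ((S0.mul S2).const_mul (y ^ 2 / (m0 * m2)).toNNReal)).add
      ((S1.mul S2).const_mul (z ^ 2 / (m1 * m2)).toNNReal)).add
      (((S0.mul S1).mul S2).const_mul (2 * x * y * z / (m0 * m1 * m2)).toNNReal)
    convert h using 2 with l
    have p0 := (ps0 l).le
    have p1 := (ps1 l).le
    have p2 := (ps2 l).le
    simp only [hQ]
    rw [ENNReal.ofReal_add (by positivity) (by positivity),
      ENNReal.ofReal_add (by positivity) (by positivity),
      ENNReal.ofReal_add (by positivity) (by positivity),
      ENNReal.ofReal_mul (p := x ^ 2 / _) (by positivity),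
      ENNReal.ofReal_mul (p := y ^ 2 / _) (by positivity),
      ENNReal.ofReal_mul (p := z ^ 2 / _) (by positivity),
      ENNReal.ofReal_mul (p := 2 * x * y * z / _) (by positivity),
      ENNReal.ofReal_mul (q := s1 l) p0, ENNReal.ofReal_mul (p := s0 l) (q := s2 l) p0,
      ENNReal.ofReal_mul (p := s1 l) p1, ENNReal.ofReal_mul (p := s0 l * s1 l) (by positivity),
      ENNReal.ofReal_mul (q := s1 l) p0]
    rfl
  have h := ((((G hβ r0 0).mul (G hβ r1 1)).mul (G hβ r2 2)).mul
    (LQ.one_sub_rpow_neg pQ hQ1 hβ)).const_mul ((m0 * m1 * m2 / D ^ 2) ^ (-β)).toNNReal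
  convert h using 2 with l
  have p0 := (Real.rpow_pos_of_pos (ps0 l) β).le
  have p1 := (Real.rpow_pos_of_pos (ps1 l) β).le
  have p2 := (Real.rpow_pos_of_pos (ps2 l) β).le
  rw [hpow, ENNReal.ofReal_mul (by positivity), ENNReal.ofReal_mul (by positivity),
    ENNReal.ofReal_mul (by positivity), ENNReal.ofReal_mul (by positivity)]
  rfl

/-! ### Infinite divisibility at three points -/

namespace IsBrownianSheet

variable {Ω : Type*} [MeasurableSpace Ω] {P : Measure Ω} [IsProbabilityMeasure P]
  {W : ℝ≥0 × ℝ≥0 → Ω → ℝ}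

theorem laplace_toNNReal_sq (hW : IsBrownianSheet P W) {k : ℕ} (p : Fin k → ℝ≥0 × ℝ≥0)
    (l : Fin k → ℝ≥0) :
    laplace (P.map fun ω i => Real.toNNReal (W (p i) ω ^ 2)) l =
      ENNReal.ofReal ((1 + Matrix.diagonal (fun i => (l i : ℝ)) *
        ((2 : ℝ) • sheetGram p)).det ^ (-(1 / 2) : ℝ)) := by
  have hm := hW.measurable
  rw [← hW.integral_exp_neg_sq p (fun i => (l i).coe_nonneg), laplace,
    lintegral_map (by fun_prop) (by fun_prop), ofReal_integral_eq_lintegral_ofReal]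
  · simp [expNeg, Real.coe_toNNReal _ (sq_nonneg _)]
  · refine Integrable.of_bound (C := 1) (by fun_prop) (.of_forall fun ω => ?_)
    rw [Real.norm_of_nonneg (Real.exp_pos _).le, Real.exp_le_one_iff, neg_nonpos]
    exact Finset.sum_nonneg fun i _ => by positivity
  · exact .of_forall fun ω => (Real.exp_pos _).le

theorem isInfinitelyDivisible_of_injective (hW : IsBrownianSheet P W) {p : Fin 3 → ℝ≥0 × ℝ≥0}
    (hinj : Function.Injective p) (hpos : ∀ i, 0 < (p i).1 ∧ 0 < (p i).2) :
    IsInfinitelyDivisible (P.map fun ω (i : Fin 3) => W (p i) ω ^ 2) := by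
  have hm := hW.measurable
  set H := (2 : ℝ) • sheetGram p with hH
  have hHpd : H.PosDef := (hW.posDef hinj hpos).smul two_pos
  have key : IsInfinitelyDivisible (P.map fun ω (i : Fin 3) => Real.toNNReal (W (p i) ω ^ 2)) := by
    intro n hn
    have hn' : (0 : ℝ) < n := by exact_mod_cast hn
    obtain ⟨ν, -, hν⟩ := isLaplaceTransform_det_rpow_neg hHpd
      (fun i j k => by
        have := sheetCov_mul_sheetCov_le (p i) (p j) (p k)
        simp only [hH, sheetGram, Matrix.smul_apply, Matrix.of_apply, smul_eq_mul]
        linarith)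
      -- The exponent of the `n`-th root of `det ^ (-1/2)`.
      (β := 1 / 2 / n) (by positivity)
    have hprob : IsProbabilityMeasure ν := ⟨by
      rw [← laplace_zero, hν]
      simp⟩
    refine ⟨ν, hprob, ?_⟩
    have h1 : IsProbabilityMeasure (P.map fun ω (i : Fin 3) => Real.toNNReal (W (p i) ω ^ 2)) :=
      Measure.isProbabilityMeasure_map (by fun_prop)
    have h2 : IsProbabilityMeasure
        ((Measure.pi (fun _ : Fin n => ν)).map (fun y => ∑ k, y k)) :=
      Measure.isProbabilityMeasure_map (by fun_prop)
    refine ext_of_laplace fun l => ?_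
    have hdet : 0 ≤ (1 + Matrix.diagonal (fun i => (l i : ℝ)) * H).det :=
      (hHpd.posSemidef.det_one_add_diagonal_mul_pos fun i => (l i).coe_nonneg).le
    rw [laplace_pi_sum, hν, hW.laplace_toNNReal_sq, ← ENNReal.ofReal_pow (by positivity),
      ← Real.rpow_natCast, ← Real.rpow_mul hdet]
    congr 2
    field_simp
  have hf : Measurable ((NNReal.toRealHom : ℝ≥0 →+ ℝ).compLeft (Fin 3)) :=
    measurable_pi_iff.2 fun i => measurable_coe_nnreal_real.comp (measurable_pi_apply i)
  have h := key.map _ hf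
  rw [Measure.map_map hf (by fun_prop)] at h
  convert h using 2
  ext ω i
  exact (Real.coe_toNNReal _ (sq_nonneg _)).symm

/-- The squares of the sheet at three points have an infinitely divisible law. -/
theorem isInfinitelyDivisible_three (hW : IsBrownianSheet P W) (p : Fin 3 → ℝ≥0 × ℝ≥0) :
    IsInfinitelyDivisible (P.map fun ω (i : Fin 3) => W (p i) ω ^ 2) := by
  classical
  -- The distinct off-axis points among the `p i` are completed to exactly three points `q`; the
  -- additive map `f` recovers the squares at the `p i` by copying coordinates, with `0` for points
  -- on the axes.
  let S := {q : ℝ≥0 × ℝ≥0 // 0 < q.1 ∧ 0 < q.2}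
  have : Infinite S := Infinite.of_injective
    (fun n : ℕ => (⟨((n : ℝ≥0) + 1, 1), by positivity, one_pos⟩ : S)) fun m n h => by
      simpa [S] using h
  let s : Finset S := Finset.univ.biUnion fun i : Fin 3 =>
    if h : 0 < (p i).1 ∧ 0 < (p i).2 then {⟨p i, h⟩} else ∅
  have hs : s.card ≤ 3 := by
    refine Finset.card_biUnion_le.trans ?_
    refine (Finset.sum_le_card_nsmul _ _ 1 fun i _ => ?_).trans (by simp)
    split_ifs <;> simp
  obtain ⟨t, hst, ht⟩ := Infinite.exists_superset_card_eq s 3 hs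
  let q : Fin 3 → ℝ≥0 × ℝ≥0 := fun i => ((t.equivFinOfCardEq ht).symm i).1.1
  have hq : Function.Injective q := fun i j h =>
    (t.equivFinOfCardEq ht).symm.injective (Subtype.ext (Subtype.ext h))
  have hqpos : ∀ i, 0 < (q i).1 ∧ 0 < (q i).2 := fun i =>
    ((t.equivFinOfCardEq ht).symm i).1.2
  have hσ : ∀ i, ∃ j, (0 < (p i).1 ∧ 0 < (p i).2) → p i = q j := by
    intro i
    by_cases h : 0 < (p i).1 ∧ 0 < (p i).2
    · have hmem : (⟨p i, h⟩ : S) ∈ t := hst (Finset.mem_biUnion.2 ⟨i, Finset.mem_univ _, by simp [h]⟩)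
      exact ⟨t.equivFinOfCardEq ht ⟨_, hmem⟩, fun _ => by simp [q]⟩
    · exact ⟨0, fun h' => absurd h' h⟩
  choose σ hσ using hσ
  let f : (Fin 3 → ℝ) →+ (Fin 3 → ℝ) :=
    { toFun := fun y i => if 0 < (p i).1 ∧ 0 < (p i).2 then y (σ i) else 0
      map_zero' := by ext i; simp
      map_add' := fun y z => by ext i; simp only [Pi.add_apply]; split_ifs <;> simp }
  have hf : Measurable f := measurable_pi_iff.2 fun i => by
    by_cases h : 0 < (p i).1 ∧ 0 < (p i).2
    · simpa [f, h] using measurable_pi_apply (σ i)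
    · simp [f, h]
  have hm := hW.measurable
  have h := (hW.isInfinitelyDivisible_of_injective hq hqpos).map f hf
  rw [Measure.map_map hf (by fun_prop)] at h
  convert h using 1
  refine Measure.map_congr ?_
  have hz : ∀ i, ∀ᵐ ω ∂P, ¬ (0 < (p i).1 ∧ 0 < (p i).2) → W (p i) ω = 0 := by
    intro i
    by_cases h : 0 < (p i).1 ∧ 0 < (p i).2
    · simp [h]
    · filter_upwards [hW.ae_eq_zero h] with ω hω _ using hω
  filter_upwards [ae_all_iff.2 hz] with ω hω
  ext i
  by_cases h : 0 < (p i).1 ∧ 0 < (p i).2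
  · simp [f, h, ← hσ i h]
  · simp [f, h, hω i h]

end IsBrownianSheet

/-! ### A necessary condition for infinite divisibility -/

section Necessity

variable {ι : Type*} [Fintype ι]

/-- The exponential `x ↦ exp (-⟨l, x⟩)`. -/
noncomputable def realExpNeg (l x : ι → ℝ) : ℝ := Real.exp (-∑ i, l i * x i)

theorem realExpNeg_add_left (l m x : ι → ℝ) :
    realExpNeg (l + m) x = realExpNeg l x * realExpNeg m x := by
  simp only [realExpNeg, ← Real.exp_add, Pi.add_apply, add_mul, Finset.sum_add_distrib]
  congr 1; ring

theorem realExpNeg_sum_left {κ : Type*} (l x : ι → ℝ) (s : Finset κ) (h : κ → ι → ℝ) :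
    realExpNeg (l + ∑ j ∈ s, h j) x = realExpNeg l x * ∏ j ∈ s, realExpNeg (h j) x := by
  classical
  induction s using Finset.induction_on with
  | empty => simp
  | insert a s ha ih =>
    rw [Finset.sum_insert ha, Finset.prod_insert ha, add_left_comm, add_comm,
      realExpNeg_add_left, ih]
    ring

theorem realExpNeg_sum_right {κ : Type*} (l : ι → ℝ) (s : Finset κ) (y : κ → ι → ℝ) :
    realExpNeg l (∑ k ∈ s, y k) = ∏ k ∈ s, realExpNeg l (y k) := by
  simp only [realExpNeg, ← Real.exp_sum, Finset.sum_apply, Finset.mul_sum, Finset.sum_neg_distrib]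
  rw [Finset.sum_comm]

@[fun_prop]
theorem measurable_realExpNeg (l : ι → ℝ) : Measurable (realExpNeg l) := by
  unfold realExpNeg; fun_prop

theorem realExpNeg_pos (l x : ι → ℝ) : 0 < realExpNeg l x := Real.exp_pos _

theorem realExpNeg_le_one {l x : ι → ℝ} (hl : ∀ i, 0 ≤ l i) (hx : ∀ i, 0 ≤ x i) :
    realExpNeg l x ≤ 1 :=
  Real.exp_le_one_iff.2 (neg_nonpos.2 (Finset.sum_nonneg fun i _ => mul_nonneg (hl i) (hx i)))

theorem integrable_realExpNeg {ν : Measure (ι → ℝ)} [IsFiniteMeasure ν]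
    (hν : ∀ᵐ x ∂ν, ∀ i, 0 ≤ x i) {l : ι → ℝ} (hl : ∀ i, 0 ≤ l i) :
    Integrable (realExpNeg l) ν := by
  refine Integrable.of_bound (C := 1) (by fun_prop) ?_
  filter_upwards [hν] with x hx
  rw [Real.norm_of_nonneg (realExpNeg_pos _ _).le]
  exact realExpNeg_le_one hl hx

/-- The alternating differences of the Laplace transform of a measure on the orthant are
nonnegative. -/
theorem sum_powerset_integral_realExpNeg_nonneg {κ : Type*} {ν : Measure (ι → ℝ)}
    [IsFiniteMeasure ν] (hν : ∀ᵐ x ∂ν, ∀ i, 0 ≤ x i) {l : ι → ℝ} (hl : ∀ i, 0 ≤ l i)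
    {h : κ → ι → ℝ} (hh : ∀ j i, 0 ≤ h j i) (s : Finset κ) :
    0 ≤ ∑ T ∈ s.powerset, (-1 : ℝ) ^ T.card * ∫ x, realExpNeg (l + ∑ j ∈ T, h j) x ∂ν := by
  have hint : ∀ T : Finset κ, Integrable (realExpNeg (l + ∑ j ∈ T, h j)) ν := fun T =>
    integrable_realExpNeg hν fun i => by
      rw [Pi.add_apply, Finset.sum_apply]
      exact add_nonneg (hl i) (Finset.sum_nonneg fun j _ => hh j i)
  simp_rw [← integral_const_mul]
  rw [← integral_finsetSum _ fun T _ => (hint T).const_mul _]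
  refine integral_nonneg_of_ae ?_
  filter_upwards [hν] with x hx
  -- Under the integral the alternating sum factors into a product of nonnegative terms.
  have : ∑ T ∈ s.powerset, (-1 : ℝ) ^ T.card * realExpNeg (l + ∑ j ∈ T, h j) x =
      realExpNeg l x * ∏ j ∈ s, (1 - realExpNeg (h j) x) := by
    simp_rw [sub_eq_add_neg]
    rw [Finset.prod_one_add, Finset.mul_sum]
    refine Finset.sum_congr rfl fun T _ => ?_
    rw [realExpNeg_sum_left, Finset.prod_neg]
    ring
  rw [this]
  exact mul_nonneg (realExpNeg_pos _ _).le
    (Finset.prod_nonneg fun j _ => sub_nonneg.2 (realExpNeg_le_one (hh j) hx))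

/-- The alternating differences of the logarithm of the Laplace transform of an infinitely
divisible law on the orthant are nonnegative. -/
theorem IsInfinitelyDivisible.sum_powerset_log_nonneg {κ : Type*} {μ : Measure (ι → ℝ)}
    (hdiv : IsInfinitelyDivisible μ) (hμ : ∀ᵐ x ∂μ, ∀ i, 0 ≤ x i)
    (hpos : ∀ l : ι → ℝ, (∀ i, 0 ≤ l i) → 0 < ∫ x, realExpNeg l x ∂μ)
    {l : ι → ℝ} (hl : ∀ i, 0 ≤ l i) {h : κ → ι → ℝ} (hh : ∀ j i, 0 ≤ h j i) {s : Finset κ}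
    (hs : s.Nonempty) :
    0 ≤ ∑ T ∈ s.powerset,
      (-1 : ℝ) ^ T.card * Real.log (∫ x, realExpNeg (l + ∑ j ∈ T, h j) x ∂μ) := by
  have hlT : ∀ (T : Finset κ) i, 0 ≤ (l + ∑ j ∈ T, h j) i := fun T i => by
    rw [Pi.add_apply, Finset.sum_apply]
    exact add_nonneg (hl i) (Finset.sum_nonneg fun j _ => hh j i)
  have hroot : ∀ n : ℕ, 1 ≤ n → 0 ≤ ∑ T ∈ s.powerset, (-1 : ℝ) ^ T.card *
      (∫ x, realExpNeg (l + ∑ j ∈ T, h j) x ∂μ) ^ ((n : ℝ)⁻¹) := by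
    intro n hn
    obtain ⟨ν, hν, hμν⟩ := hdiv n hn
    -- The `n`-th root also lives on the orthant: otherwise all `n` independent copies would have a
    -- negative `i`-th coordinate with positive probability, and so would their sum.
    have hnn : ∀ᵐ x ∂ν, ∀ i, 0 ≤ x i := by
      refine ae_all_iff.2 fun i => ?_
      have h1 : (Measure.pi (fun _ : Fin n => ν)) (Set.univ.pi fun _ => {x | x i < 0}) = 0 := by
        have h2 := ae_all_iff.1 hμ i
        rw [hμν, ae_map_iff (by fun_prop) (measurableSet_le (by fun_prop) (by fun_prop)),
          ae_iff] at h2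
        refine measure_mono_null (fun y hy => ?_) h2
        have hy' : ∀ k, y k i < 0 := fun k => hy k (Set.mem_univ k)
        have : Nonempty (Fin n) := ⟨⟨0, hn⟩⟩
        simpa using Finset.sum_neg (fun k _ => hy' k) Finset.univ_nonempty
      rw [Measure.pi_pi, Finset.prod_const, pow_eq_zero_iff (by simp; omega)] at h1
      rw [ae_iff]
      simpa using h1
    have hpow : ∀ m : ι → ℝ, (∫ x, realExpNeg m x ∂ν) ^ n = ∫ x, realExpNeg m x ∂μ := by
      intro m
      rw [hμν, integral_map (by fun_prop) (by fun_prop)]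
      simp_rw [realExpNeg_sum_right]
      rw [integral_fintype_prod_eq_pow (f := realExpNeg m), Fintype.card_fin]
    have := sum_powerset_integral_realExpNeg_nonneg hnn hl hh s
    convert this using 3 with T
    rw [← hpow, Real.pow_rpow_inv_natCast
      (integral_nonneg fun x => (realExpNeg_pos _ _).le) (by omega)]
  have hlim : Filter.Tendsto (fun n : ℕ => ∑ T ∈ s.powerset, (-1 : ℝ) ^ T.card *
      (((n : ℝ)⁻¹)⁻¹ * ((∫ x, realExpNeg (l + ∑ j ∈ T, h j) x ∂μ) ^ ((n : ℝ)⁻¹) - 1)))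
      Filter.atTop (𝓝 (∑ T ∈ s.powerset,
        (-1 : ℝ) ^ T.card * Real.log (∫ x, realExpNeg (l + ∑ j ∈ T, h j) x ∂μ))) := by
    refine tendsto_finsetSum _ fun T _ => Filter.Tendsto.const_mul _ ?_
    refine (tendsto_rpow_sub_one_log (hpos _ (hlT T))).comp ?_
    exact tendsto_inv_atTop_nhdsGT_zero.comp tendsto_natCast_atTop_atTop
  refine ge_of_tendsto hlim ?_
  filter_upwards [Filter.eventually_ge_atTop 1] with n hn
  -- Differences of positive order kill the constant in `n (φ ^ (1/n) - 1)`; this is where `s` must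
  -- be nonempty.
  have hsum : ∑ T ∈ s.powerset, (-1 : ℝ) ^ T.card = 0 := by
    have := Finset.sum_powerset_neg_one_pow_card_of_nonempty hs
    exact_mod_cast this
  have : ∑ T ∈ s.powerset, (-1 : ℝ) ^ T.card *
      (((n : ℝ)⁻¹)⁻¹ * ((∫ x, realExpNeg (l + ∑ j ∈ T, h j) x ∂μ) ^ ((n : ℝ)⁻¹) - 1)) =
      n * (∑ T ∈ s.powerset, (-1 : ℝ) ^ T.card *
        (∫ x, realExpNeg (l + ∑ j ∈ T, h j) x ∂μ) ^ ((n : ℝ)⁻¹)) := by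
    rw [← sub_zero (∑ T ∈ s.powerset, (-1 : ℝ) ^ T.card * (∫ x, realExpNeg _ x ∂μ) ^ ((n : ℝ)⁻¹)),
      ← hsum, ← Finset.sum_sub_distrib, Finset.mul_sum]
    exact Finset.sum_congr rfl fun T _ => by rw [inv_inv]; ring
  rw [this]
  exact mul_nonneg (Nat.cast_nonneg n) (hroot n hn)

end Necessity

/-! ### Failure at four points -/

/-- The corners of a square whose projections on both axes are `{1, 2}`. -/
noncomputable def cornerPoints : Fin 4 → ℝ≥0 × ℝ≥0 := ![(1, 1), (1, 2), (2, 1), (2, 2)]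

theorem sheetGram_cornerPoints : sheetGram cornerPoints =
    !![1, 1, 1, 1; 1, 2, 1, 2; 1, 1, 2, 2; 1, 2, 2, 4] := by
  ext i j
  fin_cases i <;> fin_cases j <;> simp [sheetGram, sheetCov, cornerPoints]; norm_num

/-- The positive entry at `(0, 3)` means that, given the other two corners, the sheet at `(1, 1)`
and `(2, 2)` is negatively correlated. -/
theorem inv_sheetGram_cornerPoints : (sheetGram cornerPoints)⁻¹ =
    !![4, -2, -2, 1; -2, 2, 1, -1; -2, 1, 2, -1; 1, -1, -1, 1] := by
  rw [sheetGram_cornerPoints]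
  refine Matrix.inv_eq_right_inv ?_
  ext i j
  fin_cases i <;> fin_cases j <;> simp [Matrix.mul_apply, Fin.sum_univ_four] <;> norm_num

theorem isUnit_det_sheetGram_cornerPoints : IsUnit (sheetGram cornerPoints).det := by
  rw [sheetGram_cornerPoints]
  simp [Matrix.det_succ_row_zero, Fin.sum_univ_succ, Fin.succAbove]
  norm_num

/-- The coefficients are the principal minors of twice the covariance matrix. -/
theorem det_one_add_diagonal_mul_cornerPoints (m : Fin 4 → ℝ) :
    (1 + Matrix.diagonal m * ((2 : ℝ) • sheetGram cornerPoints)).det =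
      1 + 2 * m 0 + 4 * m 1 + 4 * m 2 + 8 * m 3 + 4 * m 0 * m 1 + 4 * m 0 * m 2 + 12 * m 0 * m 3 +
         12 * m 1 * m 2 + 16 * m 1 * m 3 + 16 * m 2 * m 3 + 8 * m 0 * m 1 * m 2 +
         16 * m 0 * m 1 * m 3 + 16 * m 0 * m 2 * m 3 + 32 * m 1 * m 2 * m 3 +
         16 * m 0 * m 1 * m 2 * m 3 := by
  rw [sheetGram_cornerPoints]
  simp [Matrix.det_succ_row_zero, Fin.sum_univ_succ, Fin.succAbove, Matrix.one_apply]
  ring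

theorem IsBrownianSheet.not_isInfinitelyDivisible_cornerPoints {Ω : Type*} [MeasurableSpace Ω]
    {P : Measure Ω} [IsProbabilityMeasure P] {W : ℝ≥0 × ℝ≥0 → Ω → ℝ}
    (hW : IsBrownianSheet P W) :
    ¬ IsInfinitelyDivisible (P.map fun ω (i : Fin 4) => W (cornerPoints i) ω ^ 2) := by
  intro hdiv
  have hm := hW.measurable
  have hmeas : Measurable fun ω (i : Fin 4) => W (cornerPoints i) ω ^ 2 := by fun_prop
  have hφ : ∀ m : Fin 4 → ℝ, (∀ i, 0 ≤ m i) →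
      ∫ x, realExpNeg m x ∂(P.map fun ω (i : Fin 4) => W (cornerPoints i) ω ^ 2) =
        (1 + Matrix.diagonal m * ((2 : ℝ) • sheetGram cornerPoints)).det ^ (-(1 / 2) : ℝ) := by
    intro m hm0
    rw [integral_map hmeas.aemeasurable (by fun_prop), ← hW.integral_exp_neg_sq _ hm0]
    rfl
  have hdet : ∀ m : Fin 4 → ℝ, (∀ i, 0 ≤ m i) →
      0 < (1 + Matrix.diagonal m * ((2 : ℝ) • sheetGram cornerPoints)).det := fun m hm0 =>
    ((hW.posSemidef _).smul zero_le_two).det_one_add_diagonal_mul_pos hm0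
  -- A third-order difference in the last three variables, with step `1 / 2` and the first variable
  -- held at `5`. The determinants are `11` at the base point, `23, 23, 45` after one step, `48, 81,
  -- 81` after two and `144` after three.
  let l : Fin 4 → ℝ := ![5, 0, 0, 0]
  let h : Fin 3 → Fin 4 → ℝ := ![![0, 1 / 2, 0, 0], ![0, 0, 1 / 2, 0], ![0, 0, 0, 1 / 2]]
  have hl : ∀ i, 0 ≤ l i := by intro i; fin_cases i <;> simp [l]
  have hh : ∀ j i, 0 ≤ h j i := by intro j i; fin_cases j <;> fin_cases i <;> simp [h]
  have hlT : ∀ (T : Finset (Fin 3)) i, 0 ≤ (l + ∑ j ∈ T, h j) i := fun T i => by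
    rw [Pi.add_apply, Finset.sum_apply]
    exact add_nonneg (hl i) (Finset.sum_nonneg fun j _ => hh j i)
  have key := hdiv.sum_powerset_log_nonneg
    ((ae_map_iff hmeas.aemeasurable (by measurability)).2
      (.of_forall fun ω i => sq_nonneg _))
    (fun m hm0 => by rw [hφ m hm0]; exact Real.rpow_pos_of_pos (hdet m hm0) _)
    hl hh (s := Finset.univ) Finset.univ_nonempty
  have hterm : ∀ T : Finset (Fin 3), (-1 : ℝ) ^ T.card *
      Real.log (∫ x, realExpNeg (l + ∑ j ∈ T, h j) x
        ∂(P.map fun ω (i : Fin 4) => W (cornerPoints i) ω ^ 2)) =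
      -(1 / 2) * ((-1 : ℝ) ^ T.card * Real.log (1 + Matrix.diagonal (l + ∑ j ∈ T, h j) *
        ((2 : ℝ) • sheetGram cornerPoints)).det) := by
    intro T
    rw [hφ _ (hlT T), Real.log_rpow (hdet _ (hlT T))]
    ring
  simp_rw [hterm, det_one_add_diagonal_mul_cornerPoints] at key
  rw [← Finset.mul_sum, show (Finset.univ : Finset (Fin 3)).powerset =
    {∅, {0}, {1}, {2}, {0, 1}, {0, 2}, {1, 2}, {0, 1, 2}} by decide] at key
  repeat rw [Finset.sum_insert (by decide)] at key
  rw [Finset.sum_singleton] at key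
  simp [l, h] at key
  norm_num at key
  -- The necessary condition would give the reverse inequality; the products are `3427920` and
  -- `3464208`.
  have hlt : Real.log (23 * 23 * 45 * 144) < Real.log (11 * 48 * 81 * 81) :=
    Real.log_lt_log (by norm_num) (by norm_num)
  repeat rw [Real.log_mul (by norm_num) (by norm_num)] at hlt
  linarith

theorem proposition5p1 {Ω : Type*} [MeasurableSpace Ω] (P : Measure Ω) [IsProbabilityMeasure P]
    (W : ℝ≥0 × ℝ≥0 → Ω → ℝ) (hW : IsBrownianSheet P W) :
    -- (i) the square of every three-point vector is infinitely divisible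
    (∀ p : Fin 3 → ℝ≥0 × ℝ≥0,
      IsInfinitelyDivisible (P.map (fun ω (i : Fin 3) => W (p i) ω ^ 2))) ∧
    -- (ii) the squared process is not infinitely divisible
    ¬ IsInfinitelyDivisible (P.map (fun ω (q : ℝ≥0 × ℝ≥0) => W q ω ^ 2)) ∧
    -- the failure occurs already at four points, where the inverse covariance is not an M-matrix
    ∃ (p : Fin 4 → ℝ≥0 × ℝ≥0) (G : Matrix (Fin 4) (Fin 4) ℝ),
      (∀ i j, G i j = sheetCov (p i) (p j)) ∧ IsUnit G.det ∧
      (∃ i j, i ≠ j ∧ 0 < G⁻¹ i j) ∧ ¬ IsMMatrix G⁻¹ ∧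
      ¬ IsInfinitelyDivisible (P.map (fun ω (i : Fin 4) => W (p i) ω ^ 2)) := by
  have hm := hW.measurable
  have hpos : 0 < (sheetGram cornerPoints)⁻¹ 0 3 := by
    rw [inv_sheetGram_cornerPoints]; simp
  refine ⟨hW.isInfinitelyDivisible_three, fun h => ?_, cornerPoints, sheetGram cornerPoints,
    fun _ _ => rfl, isUnit_det_sheetGram_cornerPoints, ⟨0, 3, by decide, hpos⟩,
    fun h => (h.1 0 3 (by decide)).not_gt hpos, hW.not_isInfinitelyDivisible_cornerPoints⟩
  let f : (ℝ≥0 × ℝ≥0 → ℝ) →+ (Fin 4 → ℝ) :=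
    { toFun := fun y i => y (cornerPoints i)
      map_zero' := rfl
      map_add' := fun _ _ => rfl }
  have hf : Measurable f := measurable_pi_iff.2 fun i => measurable_pi_apply (cornerPoints i)
  have h4 := h.map f hf
  rw [Measure.map_map hf (by fun_prop)] at h4
  exact hW.not_isInfinitelyDivisible_cornerPoints h4
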